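/- Let $k$ be a commutative ring with unit, let $n\geq 0$ be an integer and let $\varepsilon\in k$ be invertible. A braided rook $n$-diagram consists of two columns of $n$ nodes, some of the left-hand nodes being joined to right-hand nodes, each node to at most one other node, by pairwise disjoint strands in $\mathbb{C}\times[0,1]$ that run monotonically from left to right (so strands cross over or under each other); diagrams are taken up to isotopy fixing the end points and keeping the strands disjoint. The braided rook algebra $B\mathcal{R}_n(\varepsilon)$ is the $k$-algebra that is free as a $k$-module on the braided rook $n$-diagrams, with multiplication the bilinear extension of $x\cdot y=\varepsilon^{c(x,y)}\,(x\circ y)$. Here $x\circ y$ is obtained by placing $x$ to the left of $y$, identifying the right-hand nodes of $x$ with the left-hand nodes of $y$, keeping the strands that run all the way from left to right and removing the others, and $c(x,y)$ is the number of middle nodes at which neither a strand of $x$ nor a strand of $y$ ends. The trivial module $\mathbb{1}$ of $B\mathcal{R}_n(\varepsilon)$, left or right, is $k$, on which diagrams with no missing edges act as $1$ and all other diagrams act as $0$. Let $B_n$ be the braid group on $n$ strands, $k[B_n]$ its group algebra, and $\mathbb{1}$ also the trivial $k[B_n]$-module $k$. Then there are isomorphisms of graded $k$-modules $$\mathrm{Tor}_{\star}^{B\mathcal{R}_n(\varepsilon)}(\mathbb{1},\mathbb{1})\;\cong\;\mathrm{Tor}_{\star}^{k[B_n]}(\mathbb{1},\mathbb{1})\;\cong\;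 H_{\star}(B_n;k).$$ -/

import Mathlib

universe u

open CategoryTheory
open scoped TensorProduct

noncomputable section

/-! ## Configuration spaces of the plane and the braid group -/

/-- The space of configurations of pairwise distinct points of the plane `ℂ`, indexed by `S`. -/
abbrev Conf (S : Type) : Type := {x : S → ℂ // Function.Injective x}

namespace Conf

/-- Reindexing (and, at the same time, forgetting points of) a configuration. -/
def pull {S T : Type} (φ : S ↪ T) : C(Conf T, Conf S) where
  toFun x := ⟨fun s => x.1 (φ s), x.2.comp φ.injective⟩
  continuous_toFun := by
    refine Continuous.subtype_mk (continuous_pi fun s => ?_) _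
    exact (continuous_apply (φ s)).comp continuous_subtype_val

/-- The configuration of the nodes `φ s`, where the node `i : Fin n` is the point `i` of `ℂ`. -/
def std {S : Type} {n : ℕ} (φ : S ↪ Fin n) : Conf S :=
  ⟨fun s => ((φ s : ℕ) : ℂ), fun s t h => φ.injective (Fin.ext (by simpa using h))⟩

/-- The symmetric group acts on ordered configurations by relabelling the points. -/
instance (n : ℕ) : MulAction (Equiv.Perm (Fin n)) (Conf (Fin n)) where
  smul σ x := ⟨fun i => x.1 (σ⁻¹ i), x.2.comp (σ⁻¹).injective⟩
  one_smul _ := rfl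
  mul_smul σ τ x := Subtype.ext (funext fun i => by
    change x.1 ((σ * τ)⁻¹ i) = x.1 (τ⁻¹ (σ⁻¹ i))
    rw [mul_inv_rev]; rfl)

end Conf

/-- The space of `n`-element subsets of the plane: ordered configurations modulo relabelling. -/
abbrev UConf (n : ℕ) : Type := MulAction.orbitRel.Quotient (Equiv.Perm (Fin n)) (Conf (Fin n))

/-- The set of nodes `{0, …, n - 1} ⊆ ℂ`. -/
def UConf.base (n : ℕ) : UConf n :=
  Quotient.mk (MulAction.orbitRel (Equiv.Perm (Fin n)) (Conf (Fin n)))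
    (Conf.std (Function.Embedding.refl (Fin n)))

/-- The braid group on `n` strands, as the fundamental group of the space of `n`-element subsets
of the plane. -/
abbrev BraidGroup (n : ℕ) : Type := FundamentalGroup (UConf n) (UConf.base n)

/-! ## Braided rook diagrams -/

section Connections

variable {n : ℕ}

/-- The left-hand nodes at which a strand starts. -/
abbrev PEquiv.Dom (f : Fin n ≃. Fin n) : Type := {i : Fin n // (f i).isSome}

/-- The inclusion of the connected left-hand nodes into all left-hand nodes. -/
def PEquiv.src (f : Fin n ≃. Fin n) : f.Dom ↪ Fin n := Function.Embedding.subtype _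

/-- The right-hand node to which a connected left-hand node is connected. -/
def PEquiv.tgt (f : Fin n ≃. Fin n) : f.Dom ↪ Fin n where
  toFun i := (f i.1).get i.2
  inj' i j h := Subtype.ext (f.inj (Option.get_mem i.2)
    (by dsimp only at h; rw [h]; exact Option.get_mem j.2))

theorem PEquiv.trans_apply' (f g : Fin n ≃. Fin n) (i : Fin n) :
    f.trans g i = (f i).bind g := rfl

theorem PEquiv.Dom.isSome_left {f g : Fin n ≃. Fin n} (i : (f.trans g).Dom) :
    (f i.1).isSome := by
  have h := i.2
  rw [PEquiv.trans_apply'] at h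
  cases hf : f i.1 with
  | none => simp [hf] at h
  | some j => rfl

theorem PEquiv.Dom.isSome_right {f g : Fin n ≃. Fin n} (i : (f.trans g).Dom) :
    (g ((f i.1).get i.isSome_left)).isSome := by
  have h := i.2
  rw [PEquiv.trans_apply'] at h
  rwa [← Option.some_get i.isSome_left] at h

/-- A strand of a concatenation, seen as a strand of the first factor. -/
def PEquiv.fstStrand (f g : Fin n ≃. Fin n) : (f.trans g).Dom ↪ f.Dom where
  toFun i := ⟨i.1, i.isSome_left⟩
  inj' _ _ h := Subtype.ext (congrArg (fun x => x.1) h)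

/-- A strand of a concatenation, seen as a strand of the second factor. -/
def PEquiv.sndStrand (f g : Fin n ≃. Fin n) : (f.trans g).Dom ↪ g.Dom where
  toFun i := ⟨(f i.1).get i.isSome_left, i.isSome_right⟩
  inj' i j h := Subtype.ext (congrArg (fun x => x.1)
    (f.tgt.injective (a₁ := ⟨i.1, i.isSome_left⟩) (a₂ := ⟨j.1, j.isSome_left⟩)
      (congrArg (fun x => x.1) h)))

theorem PEquiv.tgt_trans (f g : Fin n ≃. Fin n) (i : (f.trans g).Dom) :
    (f.trans g).tgt i = g.tgt (f.sndStrand g i) := by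
  have h : f.trans g i.1 = g ((f i.1).get i.isSome_left) := by
    rw [PEquiv.trans_apply']
    conv_lhs => rw [← Option.some_get i.isSome_left]
    rfl
  change (f.trans g i.1).get i.2 = (g ((f i.1).get i.isSome_left)).get i.isSome_right
  simp only [h]

theorem PEquiv.std_fst_src (f g : Fin n ≃. Fin n) :
    Conf.std (f.trans g).src = Conf.pull (f.fstStrand g) (Conf.std f.src) := rfl

theorem PEquiv.std_fst_tgt (f g : Fin n ≃. Fin n) :
    Conf.pull (f.fstStrand g) (Conf.std f.tgt) =
      Conf.pull (f.sndStrand g) (Conf.std g.src) := rfl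

theorem PEquiv.std_snd_tgt (f g : Fin n ≃. Fin n) :
    Conf.std (f.trans g).tgt = Conf.pull (f.sndStrand g) (Conf.std g.tgt) :=
  Subtype.ext (funext fun i => congrArg (fun j : Fin n => ((j : ℕ) : ℂ)) (f.tgt_trans g i))

theorem PEquiv.std_refl :
    Conf.std (PEquiv.refl (Fin n)).tgt = Conf.std (PEquiv.refl (Fin n)).src := rfl

/-- The nodes of the middle column of a concatenation at which neither factor has a strand. -/
def PEquiv.isolated (f g : Fin n ≃. Fin n) : Finset (Fin n) :=
  {j | f.symm j = none ∧ g j = none}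

theorem PEquiv.isolated_card_assoc (f g h : Fin n ≃. Fin n) :
    (f.isolated g).card + ((f.trans g).isolated h).card =
      (g.isolated h).card + (f.isolated (g.trans h)).card := by
  classical
  have e₁ : (f.trans g).isolated h =
      g.isolated h ∪
        ({j | (∃ i, g i = some j ∧ f.symm i = none) ∧ h j = none} : Finset (Fin n)) := by
    ext j
    simp only [Finset.mem_filter, Finset.mem_univ, true_and, Finset.mem_union,
      PEquiv.isolated, PEquiv.symm_trans_rev, PEquiv.trans_apply']
    cases hg : g.symm j with
    | none =>
      have : ∀ i, g i ≠ some j := fun i hi => by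
        rw [← PEquiv.eq_some_iff, hg] at hi; cases hi
      simp [hg, this]
    | some i =>
      have : ∀ i', g i' = some j ↔ i' = i := fun i' => by
        rw [← PEquiv.eq_some_iff, hg, Option.some_inj, eq_comm]
      simp [hg, this]
  have e₂ : f.isolated (g.trans h) =
      f.isolated g ∪
        ({i | f.symm i = none ∧ ∃ j, g i = some j ∧ h j = none} : Finset (Fin n)) := by
    ext i
    simp only [Finset.mem_filter, Finset.mem_univ, true_and, Finset.mem_union,
      PEquiv.isolated, PEquiv.trans_apply']
    cases hg : g i <;> simp [hg]
  have d₁ : Disjoint (g.isolated h)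
      ({j | (∃ i, g i = some j ∧ f.symm i = none) ∧ h j = none} : Finset (Fin n)) := by
    rw [PEquiv.isolated, Finset.disjoint_filter]
    rintro j - ⟨hj, -⟩ ⟨⟨i, hi, -⟩, -⟩
    rw [← PEquiv.eq_some_iff, hj] at hi; cases hi
  have d₂ : Disjoint (f.isolated g)
      ({i | f.symm i = none ∧ ∃ j, g i = some j ∧ h j = none} : Finset (Fin n)) := by
    rw [PEquiv.isolated, Finset.disjoint_filter]
    rintro i - ⟨-, hi⟩ ⟨-, j, hj, -⟩
    rw [hi] at hj; cases hj
  have c : ({i | f.symm i = none ∧ ∃ j, g i = some j ∧ h j = none} : Finset (Fin n)).card =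
      ({j | (∃ i, g i = some j ∧ f.symm i = none) ∧ h j = none} : Finset (Fin n)).card := by
    refine Finset.card_bij' (fun i _ => (g i).getD i) (fun j _ => (g.symm j).getD j) ?_ ?_ ?_ ?_
    · intro i hi
      simp only [Finset.mem_filter, Finset.mem_univ, true_and] at hi ⊢
      obtain ⟨hi, j, hj, hh⟩ := hi
      simp only [hj, Option.getD_some]
      exact ⟨⟨i, hj, hi⟩, hh⟩
    · intro j hj
      simp only [Finset.mem_filter, Finset.mem_univ, true_and] at hj ⊢
      obtain ⟨⟨i, hi, hf⟩, hh⟩ := hj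
      rw [(g.eq_some_iff).2 hi, Option.getD_some]
      exact ⟨hf, j, hi, hh⟩
    · intro i hi
      simp only [Finset.mem_filter, Finset.mem_univ, true_and] at hi
      obtain ⟨hi, j, hj, hh⟩ := hi
      simp only [hj, Option.getD_some, (g.eq_some_iff).2 hj]
    · intro j hj
      simp only [Finset.mem_filter, Finset.mem_univ, true_and] at hj
      obtain ⟨⟨i, hi, hf⟩, hh⟩ := hj
      simp only [(g.eq_some_iff).2 hi, Option.getD_some, hi]
  rw [e₁, e₂, Finset.card_union_of_disjoint d₁, Finset.card_union_of_disjoint d₂, c]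
  omega

end Connections

/-- A geometric representative of a braided rook diagram with connections `f`: pairwise disjoint
strands in `ℂ × [0, 1]`, monotone in the second coordinate, one for each connection of `f`,
the strand starting at the left-hand node `i` ending at the right-hand node `f i`. -/
abbrev StrandPath {n : ℕ} (f : Fin n ≃. Fin n) : Type := Path (Conf.std f.src) (Conf.std f.tgt)

/-- Concatenate the strands of two diagrams, keeping only those strands of either factor which
are continued in the other. -/
def StrandPath.concat {n : ℕ} {f g : Fin n ≃. Fin n} (p : StrandPath f) (q : StrandPath g) :
    StrandPath (f.trans g) :=
  ((p.map (Conf.pull (f.fstStrand g)).continuous).cast (f.std_fst_src g) rfl).trans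
    ((q.map (Conf.pull (f.sndStrand g)).continuous).cast (f.std_fst_tgt g) (f.std_snd_tgt g))

/-- The `n` horizontal strands. -/
def StrandPath.straight (n : ℕ) : StrandPath (PEquiv.refl (Fin n)) :=
  (Path.refl (Conf.std (PEquiv.refl (Fin n)).src)).cast rfl PEquiv.std_refl

/-- A braided rook `n`-diagram: two columns of `n` nodes, each node of the left-hand column being
connected to at most one node of the right-hand column and conversely, by strands which may cross
over and under each other; strands are taken up to isotopy fixing their end points and keeping
them disjoint. -/
@[ext]
structure BraidedRook (n : ℕ) : Type where
  conn : Fin n ≃. Fin n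
  strands : Path.Homotopic.Quotient (Conf.std conn.src) (Conf.std conn.tgt)

namespace BraidedRook

variable {n : ℕ}

def ofPath {f : Fin n ≃. Fin n} (p : StrandPath f) : BraidedRook n :=
  ⟨f, Path.Homotopic.Quotient.mk p⟩

theorem concat_homotopic {f g : Fin n ≃. Fin n} {p p' : StrandPath f} {q q' : StrandPath g}
    (hp : p.Homotopic p') (hq : q.Homotopic q') : (p.concat q).Homotopic (p'.concat q') :=
  Path.Homotopic.hcomp ((hp.map _).pathCast _ _) ((hq.map _).pathCast _ _)

/-- Composition of diagrams, without taking isolated middle nodes into account. -/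
instance : Mul (BraidedRook n) where
  mul x y := ⟨x.conn.trans y.conn, Quotient.map₂ StrandPath.concat
    (fun _ _ hp _ _ hq => concat_homotopic hp hq) x.strands y.strands⟩

/-- The diagram with `n` horizontal strands. -/
instance : One (BraidedRook n) where
  one := ofPath (StrandPath.straight n)

theorem one_def : (1 : BraidedRook n) = ofPath (StrandPath.straight n) := rfl

theorem ofPath_mul {f g : Fin n ≃. Fin n} (p : StrandPath f) (q : StrandPath g) :
    ofPath p * ofPath q = ofPath (p.concat q) := rfl

theorem exists_ofPath (x : BraidedRook n) :
    ∃ (f : Fin n ≃. Fin n) (p : StrandPath f), x = ofPath p := by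
  obtain ⟨f, s⟩ := x
  obtain ⟨p, rfl⟩ := Path.Homotopic.Quotient.mk_surjective s
  exact ⟨f, p, rfl⟩

theorem ofPath_congr {f f' : Fin n ≃. Fin n} (h : f = f') {p : StrandPath f} {q r : StrandPath f'}
    (hqr : r.Homotopic q)
    (hpr : ∀ t (i : Fin n) (hi : (f i).isSome) (hi' : (f' i).isSome),
      (p t).1 ⟨i, hi⟩ = (r t).1 ⟨i, hi'⟩) :
    ofPath p = ofPath q := by
  subst h
  have : p = r := by
    refine Path.ext (funext fun t => Subtype.ext (funext fun i => hpr t i.1 i.2 i.2))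
  subst this
  exact congrArg (BraidedRook.mk f) (Path.Homotopic.Quotient.eq.2 hqr)

theorem concat_apply {f g : Fin n ≃. Fin n} (p : StrandPath f) (q : StrandPath g)
    (t : unitInterval) (i : (f.trans g).Dom) :
    ((p.concat q) t).1 i = if h : (t : ℝ) ≤ 1 / 2 then
      (p ⟨2 * t, (unitInterval.mul_pos_mem_iff zero_lt_two).2 ⟨t.2.1, h⟩⟩).1 (f.fstStrand g i)
      else (q ⟨2 * t - 1, unitInterval.two_mul_sub_one_mem_iff.2 ⟨(not_le.1 h).le, t.2.2⟩⟩).1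
        (f.sndStrand g i) := by
  unfold StrandPath.concat
  rw [Path.trans_apply]
  split_ifs <;> rfl

theorem mul_assoc' (x y z : BraidedRook n) : x * y * z = x * (y * z) := by
  obtain ⟨f, p, rfl⟩ := x.exists_ofPath
  obtain ⟨g, q, rfl⟩ := y.exists_ofPath
  obtain ⟨h, r, rfl⟩ := z.exists_ofPath
  simp only [ofPath_mul]
  let a := f.fstStrand (g.trans h)
  let b := (f.sndStrand (g.trans h)).trans (g.fstStrand h)
  let c := (f.sndStrand (g.trans h)).trans (g.sndStrand h)
  let P : Path (Conf.std (f.trans (g.trans h)).src) (Conf.pull a (Conf.std f.tgt)) :=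
    (p.map (Conf.pull a).continuous).cast rfl rfl
  let Q : Path (Conf.pull a (Conf.std f.tgt)) (Conf.pull b (Conf.std g.tgt)) :=
    (q.map (Conf.pull b).continuous).cast rfl rfl
  let R : Path (Conf.pull b (Conf.std g.tgt)) (Conf.std (f.trans (g.trans h)).tgt) :=
    (r.map (Conf.pull c).continuous).cast rfl (Subtype.ext (funext fun i => by
      change (((f.trans (g.trans h)).tgt i : ℕ) : ℂ) = ((h.tgt (c i) : ℕ) : ℂ)
      rw [PEquiv.tgt_trans, PEquiv.tgt_trans]; rfl))
  have key : p.concat (q.concat r) = P.trans (Q.trans R) := by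
    refine Path.ext (funext fun t => Subtype.ext (funext fun i => ?_))
    rw [concat_apply, Path.trans_apply]
    split_ifs
    · rfl
    · rw [concat_apply, Path.trans_apply]
      split_ifs <;> rfl
  rw [key]
  refine ofPath_congr (PEquiv.trans_assoc f g h) (Path.Homotopic.trans_assoc P Q R) ?_
  intro t i hi hi'
  rw [concat_apply, Path.trans_apply]
  split_ifs
  · rw [concat_apply, Path.trans_apply]
    split_ifs <;> rfl
  · refine congrArg (r _).1 (Subtype.ext ?_)
    exact PEquiv.tgt_trans f g ((f.trans g).fstStrand h ⟨i, hi⟩)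

theorem one_mul' (x : BraidedRook n) : 1 * x = x := by
  obtain ⟨f, p, rfl⟩ := x.exists_ofPath
  rw [one_def, ofPath_mul]
  refine ofPath_congr (PEquiv.refl_trans f) (r := (Path.refl _).trans p)
    (Path.Homotopic.refl_trans p) ?_
  intro t i hi hi'
  rw [concat_apply, Path.trans_apply]
  split_ifs <;> rfl

theorem mul_one' (x : BraidedRook n) : x * 1 = x := by
  obtain ⟨f, p, rfl⟩ := x.exists_ofPath
  rw [one_def, ofPath_mul]
  refine ofPath_congr (PEquiv.trans_refl f) (r := p.trans (Path.refl _))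
    (Path.Homotopic.trans_refl p) ?_
  intro t i hi hi'
  rw [concat_apply, Path.trans_apply]
  split_ifs <;> rfl

/-- The number of contractible components created by placing `x` to the left of `y`: the nodes
of the middle column at which neither a strand of `x` ends nor a strand of `y` starts. -/
def contractible (x y : BraidedRook n) : ℕ := (x.conn.isolated y.conn).card

theorem mul_conn (x y : BraidedRook n) : (x * y).conn = x.conn.trans y.conn := rfl

theorem one_conn : (1 : BraidedRook n).conn = PEquiv.refl (Fin n) := rfl

theorem contractible_one_left (x : BraidedRook n) : contractible 1 x = 0 := by
  simp [contractible, PEquiv.isolated, one_conn]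

theorem contractible_one_right (x : BraidedRook n) : contractible x 1 = 0 := by
  simp [contractible, PEquiv.isolated, one_conn]

theorem contractible_assoc (x y z : BraidedRook n) :
    contractible x y + contractible (x * y) z = contractible y z + contractible x (y * z) :=
  PEquiv.isolated_card_assoc x.conn y.conn z.conn

/-- The diagram has no missing edges. -/
def Full (x : BraidedRook n) : Prop :=
  (∀ i, (x.conn i).isSome) ∧ ∀ j, (x.conn.symm j).isSome

theorem full_one : Full (1 : BraidedRook n) := by
  constructor <;> simp [one_conn]

theorem full_mul (x y : BraidedRook n) : Full (x * y) ↔ Full x ∧ Full y := by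
  simp only [Full, mul_conn, PEquiv.symm_trans_rev, PEquiv.trans_apply']
  have surj : ∀ f : Fin n ≃. Fin n, (∀ i, (f i).isSome) → ∀ j, ∃ i, f i = some j := by
    intro f hf j
    have hb : Function.Injective fun i => (f i).get (hf i) := fun i i' h =>
      f.inj (Option.get_mem (hf i)) (by dsimp only at h; rw [h]; exact Option.get_mem (hf i'))
    obtain ⟨i, hi⟩ := (Finite.injective_iff_surjective.1 hb) j
    exact ⟨i, by rw [← hi, Option.some_get]⟩
  have isSome_of_bind : ∀ (o : Option (Fin n)) (φ : Fin n → Option (Fin n)),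
      (o.bind φ).isSome → o.isSome := by
    intro o φ h
    cases o with
    | none => simp at h
    | some _ => rfl
  constructor
  · rintro ⟨h₁, h₂⟩
    have hx : ∀ i, (x.conn i).isSome := fun i => isSome_of_bind _ _ (h₁ i)
    have hy : ∀ j, (y.conn.symm j).isSome := fun j => isSome_of_bind _ _ (h₂ j)
    refine ⟨⟨hx, fun j => ?_⟩, ⟨fun i => ?_, hy⟩⟩
    · obtain ⟨i, hi⟩ := surj _ hx j
      rw [x.conn.eq_some_iff.2 hi]; rfl
    · obtain ⟨j, hj⟩ := surj _ hy i
      rw [y.conn.eq_some_iff.1 hj]; rfl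
  · rintro ⟨⟨hx, hx'⟩, hy, hy'⟩
    constructor
    · intro i
      obtain ⟨j, hj⟩ := Option.isSome_iff_exists.1 (hx i)
      simpa [hj] using hy j
    · intro i
      obtain ⟨j, hj⟩ := Option.isSome_iff_exists.1 (hy' i)
      simpa [hj] using hx' j

theorem contractible_of_full {x y : BraidedRook n} (hx : Full x) : contractible x y = 0 := by
  rw [contractible, Finset.card_eq_zero, PEquiv.isolated, Finset.filter_eq_empty_iff]
  rintro j - ⟨h, -⟩
  have := hx.2 j
  simp [h] at this

end BraidedRook

/-! ## The braided rook algebra -/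

/-- The braided rook algebra: formal `k`-linear combinations of braided rook `n`-diagrams. -/
def BraidedRookAlgebra (k : Type u) [CommRing k] (n : ℕ) (_ε : k) : Type u := BraidedRook n →₀ k

namespace BraidedRookAlgebra

variable {k : Type u} [CommRing k] {n : ℕ} {ε : k}

instance : AddCommGroup (BraidedRookAlgebra k n ε) :=
  inferInstanceAs (AddCommGroup (BraidedRook n →₀ k))

instance : Module k (BraidedRookAlgebra k n ε) :=
  inferInstanceAs (Module k (BraidedRook n →₀ k))

/-- A diagram, as an element of the algebra. -/
def diagram (ε : k) (x : BraidedRook n) : BraidedRookAlgebra k n ε := Finsupp.single x 1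

theorem hom_ext {M : Type*} [AddCommGroup M] [Module k M] {f g : BraidedRookAlgebra k n ε →ₗ[k] M}
    (h : ∀ x, f (diagram ε x) = g (diagram ε x)) : f = g :=
  Finsupp.lhom_ext' fun x => LinearMap.ext_ring (h x)

/-- The linear map with prescribed values on diagrams. -/
def lift {M : Type*} [AddCommGroup M] [Module k M] (φ : BraidedRook n → M) :
    BraidedRookAlgebra k n ε →ₗ[k] M :=
  Finsupp.linearCombination k φ

theorem lift_diagram {M : Type*} [AddCommGroup M] [Module k M] (φ : BraidedRook n → M)
    (x : BraidedRook n) : lift φ (diagram ε x) = φ x := by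
  exact (Finsupp.linearCombination_single k 1 x).trans (one_smul k _)

@[elab_as_elim]
theorem induction {P : BraidedRookAlgebra k n ε → Prop} (a : BraidedRookAlgebra k n ε)
    (h0 : P 0) (hadd : ∀ a b, P a → P b → P (a + b)) (hsmul : ∀ (r : k) a, P a → P (r • a))
    (hd : ∀ x, P (diagram ε x)) : P a := by
  refine Finsupp.induction_linear (motive := P) a h0 hadd fun x r => ?_
  have : Finsupp.single x r = (r • diagram ε x : BraidedRookAlgebra k n ε) := by
    refine (Eq.trans ?_ (Finsupp.smul_single r x (1 : k)).symm)
    rw [smul_eq_mul, mul_one]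
  rw [this]
  exact hsmul r _ (hd x)

/-- The multiplication: the bilinear extension of
`x, y ↦ ε ^ (number of contractible components) • (x * y)`. -/
def mulMap : BraidedRookAlgebra k n ε →ₗ[k] BraidedRookAlgebra k n ε →ₗ[k]
    BraidedRookAlgebra k n ε :=
  lift fun x => lift fun y => ε ^ BraidedRook.contractible x y • diagram ε (x * y)

theorem mulMap_diagram (x y : BraidedRook n) : mulMap (diagram ε x) (diagram ε y) =
    ε ^ BraidedRook.contractible x y • diagram ε (x * y) := by
  rw [mulMap, lift_diagram, lift_diagram]

theorem mulMap_assoc (a b c : BraidedRookAlgebra k n ε) :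
    mulMap (mulMap a b) c = mulMap a (mulMap b c) := by
  induction a using induction with
  | h0 => simp
  | hadd a a' h h' => simp [h, h']
  | hsmul r a h => simp [h]
  | hd x =>
  induction b using induction with
  | h0 => simp
  | hadd a a' h h' => simp [h, h']
  | hsmul r a h => simp [h]
  | hd y =>
  induction c using induction with
  | h0 => simp
  | hadd a a' h h' => simp [h, h']
  | hsmul r a h => simp [h]
  | hd z =>
  rw [mulMap_diagram, mulMap_diagram, map_smul, LinearMap.smul_apply, map_smul, mulMap_diagram,
    mulMap_diagram, smul_smul, smul_smul, ← pow_add, ← pow_add,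
    BraidedRook.contractible_assoc, BraidedRook.mul_assoc']

theorem mulMap_one (a : BraidedRookAlgebra k n ε) : mulMap a (diagram ε 1) = a := by
  have : mulMap.flip (diagram ε 1) = (LinearMap.id : BraidedRookAlgebra k n ε →ₗ[k] _) :=
    hom_ext fun x => by
      rw [LinearMap.flip_apply, mulMap_diagram, BraidedRook.contractible_one_right,
        BraidedRook.mul_one', pow_zero, one_smul, LinearMap.id_apply]
  exact LinearMap.congr_fun this a

theorem one_mulMap (a : BraidedRookAlgebra k n ε) : mulMap (diagram ε 1) a = a := by
  have : mulMap (diagram ε 1) = (LinearMap.id : BraidedRookAlgebra k n ε →ₗ[k] _) :=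
    hom_ext fun x => by
      rw [mulMap_diagram, BraidedRook.contractible_one_left,
        BraidedRook.one_mul', pow_zero, one_smul, LinearMap.id_apply]
  exact LinearMap.congr_fun this a

instance : Ring (BraidedRookAlgebra k n ε) where
  __ := (inferInstance : AddCommGroup (BraidedRookAlgebra k n ε))
  mul a b := mulMap a b
  one := diagram ε 1
  mul_assoc := mulMap_assoc
  mul_one := mulMap_one
  one_mul := one_mulMap
  left_distrib a b c := map_add (mulMap a) b c
  right_distrib a b c := LinearMap.map_add₂ mulMap a b c
  zero_mul a := LinearMap.map_zero₂ mulMap a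
  mul_zero a := map_zero (mulMap a)

theorem mul_def (a b : BraidedRookAlgebra k n ε) : a * b = mulMap a b := rfl

theorem one_def : (1 : BraidedRookAlgebra k n ε) = diagram ε 1 := rfl

instance : Algebra k (BraidedRookAlgebra k n ε) :=
  Algebra.ofModule (fun r a b => LinearMap.map_smul₂ mulMap r a b)
    (fun r a b => map_smul (mulMap a) r b)

open Classical in
/-- The action of the algebra on its trivial module: diagrams with no missing edges act as `1`,
all other diagrams act as `0`. -/
def aug : BraidedRookAlgebra k n ε →ₐ[k] k :=
  AlgHom.ofLinearMap (lift fun x => if x.Full then 1 else 0)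
    (by rw [one_def, lift_diagram, if_pos BraidedRook.full_one])
    (by
      intro a b
      rw [mul_def]
      induction a using induction with
      | h0 => simp
      | hadd a a' h h' => simp [h, h', add_mul]
      | hsmul r a h => simp [h, mul_assoc]
      | hd x =>
      induction b using induction with
      | h0 => simp
      | hadd a a' h h' => simp [h, h', mul_add]
      | hsmul r a h => simp [h, mul_left_comm]
      | hd y =>
      rw [mulMap_diagram, map_smul, lift_diagram, lift_diagram, lift_diagram]
      by_cases hx : x.Full
      · rw [BraidedRook.contractible_of_full hx]
        simp [BraidedRook.full_mul, hx]
      · simp [BraidedRook.full_mul, hx])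

end BraidedRookAlgebra

/-! ## Tor over a noncommutative algebra -/

namespace AlgebraTor

section

variable {k A : Type u} [CommRing k] [Ring A] [Algebra k A]

/-- Modules over a `k`-algebra are `k`-modules. -/
abbrev moduleOfAlgebra (k : Type u) {A : Type u} [CommRing k] [Ring A] [Algebra k A]
    (N : ModuleCat.{u} A) : Module k N := Module.restrictScalars k A N

attribute [local instance] moduleOfAlgebra

/-- An `A`-linear map, as a `k`-linear map. -/
def homRestrict (k : Type u) {A : Type u} [CommRing k] [Ring A] [Algebra k A]
    {N N' : ModuleCat.{u} A} (f : N ⟶ N') : N →ₗ[k] N' where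
  toFun := f.hom
  map_add' := map_add f.hom
  map_smul' r x := map_smul f.hom (algebraMap k A r) x

/-- The submodule of `M ⊗[k] N` generated by the elements `m a ⊗ x - m ⊗ a x`. -/
def balanced (k : Type u) {A : Type u} [CommRing k] [Ring A] [Algebra k A]
    (M : ModuleCat.{u} Aᵐᵒᵖ) (N : ModuleCat.{u} A) : Submodule k (M ⊗[k] N) :=
  Submodule.span k {z | ∃ (m : M) (a : A) (x : N),
    z = (MulOpposite.op a • m) ⊗ₜ[k] x - m ⊗ₜ[k] (a • x)}

theorem balanced_le_comap (M : ModuleCat.{u} Aᵐᵒᵖ) {N N' : ModuleCat.{u} A} (f : N ⟶ N') :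
    balanced k M N ≤ (balanced k M N').comap ((homRestrict k f).lTensor M) := by
  refine Submodule.span_le.2 ?_
  rintro _ ⟨m, a, x, rfl⟩
  refine Submodule.subset_span ⟨m, a, f.hom x, ?_⟩
  rw [map_sub, LinearMap.lTensor_tmul, LinearMap.lTensor_tmul]
  exact congrArg (fun y => _ - m ⊗ₜ[k] y) (map_smul f.hom a x)

/-- The functor `M ⊗_A -` from left `A`-modules to `k`-modules, for a right `A`-module `M`. -/
def tensorFunctor (k : Type u) {A : Type u} [CommRing k] [Ring A] [Algebra k A]
    (M : ModuleCat.{u} Aᵐᵒᵖ) : ModuleCat.{u} A ⥤ ModuleCat.{u} k where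
  obj N := ModuleCat.of k ((M ⊗[k] N) ⧸ balanced k M N)
  map f := ModuleCat.ofHom (Submodule.mapQ _ _ ((homRestrict k f).lTensor M)
    (balanced_le_comap M f))
  map_id N := by
    refine ModuleCat.hom_ext (Submodule.linearMap_qext _ (TensorProduct.ext' fun m x => rfl))
  map_comp f g := by
    refine ModuleCat.hom_ext (Submodule.linearMap_qext _ (TensorProduct.ext' fun m x => rfl))

instance (M : ModuleCat.{u} Aᵐᵒᵖ) : (tensorFunctor k M).Additive where
  map_add {N N' f g} := by
    refine ModuleCat.hom_ext (Submodule.linearMap_qext _ (TensorProduct.ext' fun m x => ?_))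
    exact congrArg (Submodule.Quotient.mk (p := balanced k M N'))
      (TensorProduct.tmul_add m (f.hom x) (g.hom x))

/-- `Tor_q^A(M, N)`, for a right `A`-module `M` and a left `A`-module `N`: the `q`-th left derived
functor of `M ⊗_A -`, applied to `N`. -/
def Tor (k : Type u) {A : Type u} [CommRing k] [Ring A] [Algebra k A]
    (M : ModuleCat.{u} Aᵐᵒᵖ) (N : ModuleCat.{u} A) (q : ℕ) : ModuleCat.{u} k :=
  ((tensorFunctor k M).leftDerived q).obj N

/-- The left `A`-module `k`, on which `A` acts through `α : A → k`. -/
def leftTrivial (α : A →ₐ[k] k) : ModuleCat.{u} A :=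
  (ModuleCat.restrictScalars α.toRingHom).obj (ModuleCat.of k k)

/-- The right `A`-module `k`, on which `A` acts through `α : A → k`. -/
def rightTrivial (α : A →ₐ[k] k) : ModuleCat.{u} Aᵐᵒᵖ :=
  (ModuleCat.restrictScalars
    (α.toRingHom.fromOpposite fun x y => Commute.all (α x) (α y))).obj (ModuleCat.of k k)

/-- `Tor_q^A(𝟙, 𝟙)`, where `𝟙` is `k` with `A` acting through `α : A → k`. -/
def torTrivial (α : A →ₐ[k] k) (q : ℕ) : ModuleCat.{u} k :=
  Tor k (rightTrivial α) (leftTrivial α) q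

end

end AlgebraTor

/-- The action of a group algebra on its trivial module: all group elements act as `1`. -/
def groupAug (k : Type u) [CommRing k] (G : Type) [Group G] : MonoidAlgebra k G →ₐ[k] k :=
  MonoidAlgebra.lift k k G 1

end

/-!
Write `A` for the braided rook algebra and `I` for the span of the diagrams with a missing edge.

*The quotient `A / I` is the group algebra of the braid group.* A diagram without missing edges
is a path of ordered configurations which starts at the nodes and ends at a permutation of them,
hence a loop in the space of `n`-element subsets of the plane. Since ordered configurations form a
covering of that space, loops lift uniquely up to homotopy, and diagrams without missing edges
correspond bijectively to braids (`BraidedRook.loop_injective`, `BraidedRook.exists_loop_eq`).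
This gives a surjection `BraidedRookAlgebra.toGroupAlgebra` which kills `I` and carries the
augmentation of the group algebra to the one of `A`.

*The quotient is projective.* Let `e j` be the identity diagram with the strand at `j` removed, and
let `δ` be the inverse of `ε`. If no strand of `x` ends at the right-hand node `j`, then
`x * e j = ε • x`, so that `x * (1 - δ • e j) = 0`. The product `f` of all the `1 - δ • e j` is
therefore annihilated by `I` from the left
(`BraidedRookAlgebra.diagram_mul_nonFullAnnihilator`), and it maps to `1` in the quotient. So
`a ↦ a * f` factors through a left `A`-linear section of the projection `A → A / I`, which makes
`A / I` a direct summand of the left module `A`.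

*Comparison of `Tor`.* Consequently restriction of scalars from `A / I` to `A` preserves projective
modules; it is exact, and the tensor product over `A` of modules over the quotient is their tensor
product over the quotient. A projective resolution over the group algebra thus computes both `Tor`
modules (`AlgebraTor.nonempty_torTrivial_iso`). The same comparison of resolutions
(`CategoryTheory.Functor.leftDerivedObjIsoOfComp`), applied to the equivalence between
representations and modules over the group algebra, identifies `Tor` over the group algebra with
group homology.
-/

noncomputable section

/-! ### Derived functors and change of rings -/

namespace CategoryTheory.Functor

/-- Left derived functors can be computed after applying a functor `F` which preserves homology
and projective objects. -/
def leftDerivedObjIsoOfComp {C D E : Type*} [Category C] [Category D] [Category E]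
    [Abelian C] [HasProjectiveResolutions C] [Abelian D] [HasProjectiveResolutions D] [Abelian E]
    (F : C ⥤ D) [F.Additive] [F.PreservesHomology] [F.PreservesProjectiveObjects]
    (G : D ⥤ E) [G.Additive] (H : C ⥤ E) [H.Additive] (e : F ⋙ G ≅ H) (X : C) (q : ℕ) :
    (G.leftDerived q).obj (F.obj X) ≅ (H.leftDerived q).obj X :=
  let P := projectiveResolution X
  (F.mapProjectiveResolution P).isoLeftDerivedObj G q ≪≫
    (HomologicalComplex.homologyFunctor E _ q).mapIso
      ((NatIso.mapHomologicalComplex e (ComplexShape.down ℕ)).app P.complex) ≪≫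
    (P.isoLeftDerivedObj H q).symm

end CategoryTheory.Functor

namespace ModuleCat

variable {A B : Type u} [Ring A] [Ring B]

/-- If the surjection `π : A → B` has a left `A`-linear section `j`, then `B` is a direct summand
of `A`, and restriction of scalars along `π` preserves projective modules. The section is given
together with `f = j 1`. -/
theorem projective_restrictScalars_obj (π : A →+* B) (hπ : Function.Surjective π) (f : A)
    (hf : π f = 1) (j : B →+ A) (hj : ∀ a, j (π a) = a * f) (P : ModuleCat.{u} B) [Projective P] :
    Projective ((restrictScalars π).obj P) := by
  have hP : Module.Projective B P := (IsProjective.iff_projective P).2 ‹_›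
  obtain ⟨s, hs⟩ := Module.projective_def'.1 hP
  have hj' (a : A) (b : B) : j (π a * b) = a * j b := by
    obtain ⟨b, rfl⟩ := hπ b
    rw [← map_mul, hj, hj, mul_assoc]
  have hπj (b : B) : π (j b) = b := by
    obtain ⟨b, rfl⟩ := hπ b
    rw [hj, map_mul, hf, mul_one]
  -- Applying `j` to the coefficients turns a `B`-linear section of the canonical map from a free
  -- `B`-module onto `P` into an `A`-linear section of the one from a free `A`-module.
  let P' := (restrictScalars π).obj P
  let ι : P →+ P' := AddMonoidHom.id P
  have hι (b : B) (p : P) : ι (b • p) = j b • ι p :=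
    congrArg (fun b : B => b • p) (hπj b).symm
  have key (l : P →₀ B) : Finsupp.linearCombination A ι (Finsupp.mapRange.addMonoidHom j l) =
      ι (Finsupp.linearCombination B id l) := by
    induction l using Finsupp.induction_linear with
    | zero => simp only [map_zero]
    | add l l' h h' => simp only [map_add, h, h']
    | single p b =>
      rw [Finsupp.mapRange.addMonoidHom_apply, Finsupp.mapRange_single,
        Finsupp.linearCombination_single, Finsupp.linearCombination_single, hι, id]
  let t : P' →ₗ[A] (P →₀ A) :=
    { toFun := fun p => Finsupp.mapRange.addMonoidHom j (s p)
      map_add' := fun p p' => by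
        refine (congrArg (Finsupp.mapRange.addMonoidHom j) (map_add s p p')).trans (map_add _ _ _)
      map_smul' := fun a p => by
        refine (congrArg (Finsupp.mapRange.addMonoidHom j) (map_smul s (π a) p)).trans ?_
        ext x
        exact hj' a (s p x) }
  have : Module.Projective A P' := by
    refine Module.Projective.of_split t (Finsupp.linearCombination A ι) ?_
    exact LinearMap.ext fun p => (key (s p)).trans (LinearMap.congr_fun hs p)
  exact (IsProjective.iff_projective P').1 this

instance preservesHomology_restrictScalars (π : A →+* B) :
    (restrictScalars.{u} π).PreservesHomology :=
  Functor.preservesHomology_of_map_exact _ fun S hS => by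
    rw [ShortComplex.ShortExact.moduleCat_exact_iff_function_exact] at hS ⊢
    exact hS

end ModuleCat

namespace AlgebraTor

variable {k A B : Type u} [CommRing k] [Ring A] [Ring B] [Algebra k A] [Algebra k B]

attribute [local instance] moduleOfAlgebra

/-- If `π : A → B` is surjective, then the relations which define the tensor product over `A` of
two `B`-modules are those which define the tensor product over `B`. The two `k`-module structures
on the restriction of `N`, through `A` and through `B`, agree only propositionally. -/
def tensorTrivialRestrictEquiv (π : A →ₐ[k] B) (hπ : Function.Surjective π) (β : B →ₐ[k] k)
    (N : ModuleCat.{u} B) :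
    ((rightTrivial (β.comp π) ⊗[k] ((ModuleCat.restrictScalars π.toRingHom).obj N)) ⧸
      balanced k (rightTrivial (β.comp π)) ((ModuleCat.restrictScalars π.toRingHom).obj N)) ≃ₗ[k]
    (rightTrivial β ⊗[k] N) ⧸ balanced k (rightTrivial β) N := by
  let e₁ : rightTrivial (β.comp π) ≃ₗ[k] rightTrivial β :=
    { AddEquiv.refl k with
      map_smul' := fun r x =>
        congrArg (fun c : k => c * (show k from x)) (congrArg β (π.commutes r)) }
  let e₂ : (ModuleCat.restrictScalars π.toRingHom).obj N ≃ₗ[k] N :=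
    { AddEquiv.refl N with
      map_smul' := fun r x => congrArg (fun b : B => b • (show N from x)) (π.commutes r) }
  refine Submodule.Quotient.equiv _ _ (TensorProduct.congr e₁ e₂) ?_
  rw [balanced, balanced, Submodule.map_span]
  congr 1
  ext z
  constructor
  · rintro ⟨_, ⟨m, a, x, rfl⟩, rfl⟩
    refine ⟨e₁ m, π a, e₂ x, ?_⟩
    simp
    rfl
  · rintro ⟨m, b, x, rfl⟩
    obtain ⟨a, rfl⟩ := hπ b
    refine ⟨_, ⟨e₁.symm m, a, e₂.symm x, rfl⟩, ?_⟩
    simp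
    rfl

/-- Naturality of `tensorTrivialRestrictEquiv`. -/
def tensorTrivialRestrictIso (π : A →ₐ[k] B) (hπ : Function.Surjective π) (β : B →ₐ[k] k) :
    ModuleCat.restrictScalars π.toRingHom ⋙ tensorFunctor k (rightTrivial (β.comp π)) ≅
      tensorFunctor k (rightTrivial β) :=
  NatIso.ofComponents (fun N => (tensorTrivialRestrictEquiv π hπ β N).toModuleIso) fun f => by
    refine ModuleCat.hom_ext (Submodule.linearMap_qext _ (TensorProduct.ext' fun m x => rfl))

/-- If `B` is a quotient of `A` which splits off as a left `A`-module, then `Tor` of the trivial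
modules over `B` can be computed over `A`. -/
theorem nonempty_torTrivial_iso (π : A →ₐ[k] B) (hπ : Function.Surjective π) (f : A)
    (hf : π f = 1) (j : B →+ A) (hj : ∀ a, j (π a) = a * f) (β : B →ₐ[k] k) (q : ℕ) :
    Nonempty (torTrivial (β.comp π) q ≅ torTrivial β q) := by
  have : (ModuleCat.restrictScalars.{u} π.toRingHom).PreservesProjectiveObjects :=
    ⟨fun {P} hP => ModuleCat.projective_restrictScalars_obj π.toRingHom hπ f hf j hj P⟩
  exact ⟨Functor.leftDerivedObjIsoOfComp (ModuleCat.restrictScalars π.toRingHom)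
    (tensorFunctor k (rightTrivial (β.comp π))) (tensorFunctor k (rightTrivial β))
    (tensorTrivialRestrictIso π hπ β) (leftTrivial β) q⟩

end AlgebraTor

/-! ### Group homology as `Tor` over the group algebra -/

namespace AlgebraTor

open Representation

variable {k G : Type u} [CommRing k] [Group G]

attribute [local instance] moduleOfAlgebra

/-- The tensor product over the group algebra of the trivial module with a representation `V` is
the module of coinvariants of the tensor product of representations of `k` and `V`. -/
def tensorTrivialEquivCoinvariants (V : Rep.{u} k G) :
    ((rightTrivial (MonoidAlgebra.lift k k G 1) ⊗[k] Rep.toModuleMonoidAlgebra.obj V) ⧸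
      balanced k (rightTrivial (MonoidAlgebra.lift k k G 1))
        (Rep.toModuleMonoidAlgebra.obj V)) ≃ₗ[k]
    (k ⊗[k] V) ⧸ Coinvariants.ker ((Rep.trivial k G k).ρ.tprod V.ρ) := by
  let e₁ : rightTrivial (MonoidAlgebra.lift k k G 1) ≃ₗ[k] k :=
    { AddEquiv.refl k with
      map_smul' := fun r x => congrArg (fun c : k => c * (show k from x))
        ((MonoidAlgebra.lift k k G 1).commutes r) }
  let e₂ : Rep.toModuleMonoidAlgebra.obj V ≃ₗ[k] V :=
    { AddEquiv.refl V with
      map_smul' := fun r x => algebraMap_smul (MonoidAlgebra k G) r (show V.ρ.asModule from x) }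
  have he₂ (g : G) (x : Rep.toModuleMonoidAlgebra.obj V) :
      e₂ (MonoidAlgebra.of k G g • x) = V.ρ g (e₂ x) :=
    (single_smul V.ρ 1 g x).trans (one_smul k _)
  have he₁ (a : MonoidAlgebra k G) (m : rightTrivial (MonoidAlgebra.lift k k G 1)) :
      e₁ (MulOpposite.op a • m) = MonoidAlgebra.lift k k G 1 a • e₁ m := rfl
  refine Submodule.Quotient.equiv _ _ (TensorProduct.congr e₁ e₂) (le_antisymm ?_ ?_)
  · rw [balanced, Submodule.map_span, Submodule.span_le]
    rintro _ ⟨_, ⟨m, a, x, rfl⟩, rfl⟩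
    change (TensorProduct.congr e₁ e₂) _ ∈ Coinvariants.ker ((Rep.trivial k G k).ρ.tprod V.ρ)
    rw [map_sub, TensorProduct.congr_tmul, TensorProduct.congr_tmul, he₁]
    induction a using MonoidAlgebra.induction_on with
    | of g =>
      have h := Coinvariants.sub_mem_ker (ρ := (Rep.trivial k G k).ρ.tprod V.ρ) g (e₁ m ⊗ₜ[k] e₂ x)
      rw [he₂, MonoidAlgebra.lift_of, MonoidHom.one_apply, one_smul, ← neg_sub]
      exact Submodule.neg_mem _ h
    | add a b ha hb =>
      rw [map_add, add_smul, add_smul, map_add, TensorProduct.add_tmul, TensorProduct.tmul_add,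
        add_sub_add_comm]
      exact Submodule.add_mem _ ha hb
    | smul r a ha =>
      have h : e₂ ((r • a) • x) = r • e₂ (a • x) := by
        rw [← map_smul, Algebra.smul_def, mul_smul]
        rfl
      rw [map_smul, h, TensorProduct.tmul_smul, smul_assoc, ← TensorProduct.smul_tmul']
      exact (smul_sub r (_ : k ⊗[k] V) _) ▸ Submodule.smul_mem _ r ha
  · rw [Coinvariants.ker, Submodule.span_le]
    rintro _ ⟨⟨g, x⟩, rfl⟩
    dsimp only
    induction x using TensorProduct.induction_on with
    | zero =>
      rw [map_zero, sub_zero]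
      exact Submodule.zero_mem _
    | add x y hx hy =>
      rw [map_add, add_sub_add_comm]
      exact Submodule.add_mem _ hx hy
    | tmul m v =>
      rw [← neg_sub]
      refine Submodule.neg_mem _ ⟨_, Submodule.subset_span
        ⟨e₁.symm m, MonoidAlgebra.of k G g, e₂.symm v, rfl⟩, ?_⟩
      change (TensorProduct.congr e₁ e₂) _ = _
      rw [map_sub, TensorProduct.congr_tmul, TensorProduct.congr_tmul, he₁, he₂,
        LinearEquiv.apply_symm_apply, LinearEquiv.apply_symm_apply, MonoidAlgebra.lift_of,
        MonoidHom.one_apply, one_smul]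
      rfl

instance : (Rep.toModuleMonoidAlgebra (k := k) (G := G)).Additive where
  map_add := rfl

/-- Naturality of `tensorTrivialEquivCoinvariants`. -/
def toModuleCompTensorTrivialIso :
    Rep.toModuleMonoidAlgebra ⋙ tensorFunctor k (rightTrivial (MonoidAlgebra.lift k k G 1)) ≅
      (Rep.coinvariantsTensor k G).obj (Rep.trivial k G k) :=
  NatIso.ofComponents (fun V => (tensorTrivialEquivCoinvariants V).toModuleIso) fun f => by
    refine ModuleCat.hom_ext (Submodule.linearMap_qext _ (TensorProduct.ext' fun m x => rfl))

/-- The trivial representation corresponds to the trivial module over the group algebra. -/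
def toModuleTrivialIso : Rep.toModuleMonoidAlgebra.obj (Rep.trivial k G k) ≅
    leftTrivial (MonoidAlgebra.lift k k G 1) :=
  let e : Rep.toModuleMonoidAlgebra.obj (Rep.trivial k G k) ≃ₗ[MonoidAlgebra k G]
      leftTrivial (MonoidAlgebra.lift k k G 1) :=
    { AddEquiv.refl k with
      map_smul' := fun a x => by
        change (Representation.trivial k G k).asAlgebraHom a (show k from x) =
          MonoidAlgebra.lift k k G 1 a • (show k from x)
        induction a using MonoidAlgebra.induction_on with
        | of g =>
          rw [Representation.asAlgebraHom_of, MonoidAlgebra.lift_of, MonoidHom.one_apply]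
          exact (one_smul k (show k from x)).symm
        | add a b ha hb => rw [map_add, map_add, LinearMap.add_apply, ha, hb, add_smul]
        | smul r a ha => rw [map_smul, map_smul, LinearMap.smul_apply, ha, smul_assoc] }
  e.toModuleIso

theorem nonempty_torTrivial_iso_groupHomology (q : ℕ) :
    Nonempty (torTrivial (MonoidAlgebra.lift k k G 1) q ≅
      groupHomology (Rep.trivial k G k) q) := by
  classical
  exact ⟨((tensorFunctor k _).leftDerived q).mapIso toModuleTrivialIso.symm ≪≫
    Functor.leftDerivedObjIsoOfComp Rep.toModuleMonoidAlgebra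
    (tensorFunctor k (rightTrivial (MonoidAlgebra.lift k k G 1)))
    ((Rep.coinvariantsTensor k G).obj (Rep.trivial k G k))
    toModuleCompTensorTrivialIso (Rep.trivial k G k) q ≪≫ (groupHomologyIsoTor _ q).symm⟩

end AlgebraTor

/-- Group homology is `Tor` over the group algebra. The copy of `G` in the universe of `k` has an
isomorphic group algebra, and hence the same `Tor`. -/
theorem nonempty_torTrivial_groupAug_iso_groupHomology (k : Type u) [CommRing k] (G : Type)
    [Group G] (q : ℕ) :
    Nonempty (AlgebraTor.torTrivial (groupAug k G) q ≅
      groupHomology (Rep.trivial k (ULift.{u} G) k) q) := by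
  let π : MonoidAlgebra k (ULift.{u} G) ≃ₐ[k] MonoidAlgebra k G :=
    MonoidAlgebra.domCongr k k MulEquiv.ulift
  have h : (groupAug k G).comp π.toAlgHom = MonoidAlgebra.lift k k (ULift.{u} G) 1 := by
    ext g
    simp [π, groupAug]
  obtain ⟨e⟩ := AlgebraTor.nonempty_torTrivial_iso π.toAlgHom π.surjective 1 (map_one π)
    π.symm.toRingEquiv.toAddEquiv.toAddMonoidHom (fun a => by simp) (groupAug k G) q
  rw [h] at e
  obtain ⟨e'⟩ := AlgebraTor.nonempty_torTrivial_iso_groupHomology (k := k) (G := ULift.{u} G) q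
  exact ⟨e.symm ≪≫ e'⟩

/-! ### The covering of unordered by ordered configurations -/

namespace Conf

variable {n : ℕ}

instance : ContinuousConstSMul (Equiv.Perm (Fin n)) (Conf (Fin n)) where
  continuous_const_smul σ := (pull (σ⁻¹ : Equiv.Perm (Fin n)).toEmbedding).continuous

/-- The projection from ordered to unordered configurations. -/
def proj (n : ℕ) : C(Conf (Fin n), UConf n) := ⟨Quotient.mk _, continuous_quotient_mk'⟩

theorem proj_eq_iff {x y : Conf (Fin n)} :
    proj n x = proj n y ↔ ∃ σ : Equiv.Perm (Fin n), ∀ i, y.1 (σ i) = x.1 i := by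
  refine (Quotient.eq (r := MulAction.orbitRel (Equiv.Perm (Fin n)) (Conf (Fin n)))).trans ⟨?_, ?_⟩
  · rintro ⟨σ, rfl⟩
    exact ⟨σ⁻¹, fun i => rfl⟩
  · rintro ⟨σ, h⟩
    exact ⟨σ⁻¹, Subtype.ext (funext fun i => (h i))⟩

theorem isQuotientCoveringMap_proj (n : ℕ) :
    IsQuotientCoveringMap (proj n) (Equiv.Perm (Fin n)) where
  toIsQuotientMap := isQuotientMap_quotient_mk'
  toContinuousConstSMul := inferInstance
  apply_eq_iff_mem_orbit := Quotient.eq''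
  disjoint x := by
    -- Disjoint neighbourhoods of the points of `x` confine the points of nearby configurations.
    obtain ⟨U, hU, hd⟩ := (Set.finite_range x.1).t2_separation
    have hV : IsOpen {y : Conf (Fin n) | ∀ i, y.1 i ∈ U (x.1 i)} := by
      simp only [Set.ofPred_forall]
      exact isOpen_iInter_of_finite fun i =>
        (hU (x.1 i)).2.preimage ((continuous_apply i).comp continuous_subtype_val)
    refine ⟨_, hV.mem_nhds fun i => (hU (x.1 i)).1, ?_⟩
    rintro σ ⟨_, ⟨y, hy, rfl⟩, hσ⟩
    refine Equiv.ext fun i => ?_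
    by_contra hi
    have hi' : x.1 (σ i) ≠ x.1 i := fun h => hi (x.2 h)
    refine Set.disjoint_left.1 (hd ⟨σ i, rfl⟩ ⟨i, rfl⟩ hi') (hσ (σ i)) ?_
    change y.1 (σ⁻¹ (σ i)) ∈ _
    rw [show σ⁻¹ (σ i) = i from σ.symm_apply_apply i]
    exact hy i

end Conf

/-! ### The loop of a diagram without missing edges -/

namespace BraidedRook

variable {n : ℕ}

/-- When all left-hand nodes are connected, they index the strands. -/
def fullEmb {f : Fin n ≃. Fin n} (h : ∀ i, (f i).isSome) : Fin n ↪ f.Dom :=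
  ⟨fun i => ⟨i, h i⟩, fun _ _ h => congrArg Subtype.val h⟩

theorem isSome_symm {f : Fin n ≃. Fin n} (h : ∀ i, (f i).isSome) (j : Fin n) :
    (f.symm j).isSome := by
  obtain ⟨i, hi⟩ := Finite.injective_iff_surjective.1 ((fullEmb h).trans f.tgt).injective j
  have hj : f i = some j := by rw [← hi]; exact (Option.some_get (h i)).symm
  rw [f.eq_some_iff.2 hj]
  rfl

/-- The strands of a diagram without missing edges, as a path of configurations of `n` points. -/
def orderedPath {f : Fin n ≃. Fin n} (h : ∀ i, (f i).isSome) (p : StrandPath f) :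
    Path (Conf.std (Function.Embedding.refl (Fin n))) (Conf.std ((fullEmb h).trans f.tgt)) :=
  (p.map (Conf.pull (fullEmb h)).continuous).cast rfl rfl

theorem proj_std_tgt {f : Fin n ≃. Fin n} (h : ∀ i, (f i).isSome) :
    Conf.proj n (Conf.std ((fullEmb h).trans f.tgt)) = UConf.base n :=
  Conf.proj_eq_iff.2 ⟨Equiv.ofBijective _
    (Finite.injective_iff_bijective.1 ((fullEmb h).trans f.tgt).injective), fun _ => rfl⟩

/-- The loop of subsets of the plane traced out by a diagram without missing edges. -/
def loop (x : BraidedRook n) (h : ∀ i, (x.conn i).isSome) :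
    Path.Homotopic.Quotient (UConf.base n) (UConf.base n) :=
  (x.strands.map ((Conf.proj n).comp (Conf.pull (fullEmb h)))).cast rfl (proj_std_tgt h).symm

theorem loop_mul (x y : BraidedRook n) (hx : ∀ i, (x.conn i).isSome)
    (hy : ∀ i, (y.conn i).isSome) (hxy : ∀ i, ((x * y).conn i).isSome) :
    loop (x * y) hxy = (loop x hx).trans (loop y hy) := by
  obtain ⟨f, p, rfl⟩ := x.exists_ofPath
  obtain ⟨g, q, rfl⟩ := y.exists_ofPath
  refine congrArg Path.Homotopic.Quotient.mk
    (a₁ := ((orderedPath hxy (p.concat q)).map (Conf.proj n).continuous).cast rfl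
      (proj_std_tgt hxy).symm)
    (a₂ := (((orderedPath hx p).map (Conf.proj n).continuous).cast rfl
        (proj_std_tgt hx).symm).trans
      (((orderedPath hy q).map (Conf.proj n).continuous).cast rfl (proj_std_tgt hy).symm)) ?_
  refine Path.ext (funext fun t => ?_)
  rw [Path.trans_apply]
  have key (i : Fin n) := concat_apply p q t (fullEmb hxy i)
  split_ifs with ht
  · refine congrArg (Conf.proj n) (Subtype.ext (funext fun i => ?_))
    refine (key i).trans ?_
    rw [dif_pos ht]
    rfl
  · -- The strands of the second factor are listed in the order in which those of the first end.
    refine Conf.proj_eq_iff.2 ⟨Equiv.ofBijective _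
      (Finite.injective_iff_bijective.1 ((fullEmb hx).trans f.tgt).injective), fun i => ?_⟩
    refine Eq.trans ?_ (key i).symm
    rw [dif_neg ht]
    rfl

/-- By unique path lifting the loop determines the end points of the strands, and by homotopy
lifting it determines their isotopy class. -/
theorem loop_injective {x y : BraidedRook n} (hx : ∀ i, (x.conn i).isSome)
    (hy : ∀ i, (y.conn i).isSome) (hxy : loop x hx = loop y hy) : x = y := by
  obtain ⟨f, p, rfl⟩ := x.exists_ofPath
  obtain ⟨g, q, rfl⟩ := y.exists_ofPath
  have cov := (Conf.isQuotientCoveringMap_proj n).isCoveringMap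
  let e : Conf.proj n ⁻¹' {UConf.base n} := ⟨Conf.std (Function.Embedding.refl (Fin n)), rfl⟩
  have hp : cov.monodromy (loop (ofPath p) hx) e =
      ⟨Conf.std ((fullEmb hx).trans f.tgt), proj_std_tgt hx⟩ :=
    cov.monodromy_eq_of_map_eq (Path.Homotopic.Quotient.mk (orderedPath hx p)) rfl
  have hq : cov.monodromy (loop (ofPath q) hy) e =
      ⟨Conf.std ((fullEmb hy).trans g.tgt), proj_std_tgt hy⟩ :=
    cov.monodromy_eq_of_map_eq (Path.Homotopic.Quotient.mk (orderedPath hy q)) rfl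
  have hfg : f = g := by
    rw [hxy, hq] at hp
    refine PEquiv.ext fun i => ?_
    have hi := congrFun (congrArg (fun z => z.1.1) hp) i
    have hi' : (g i).get (hy i) = (f i).get (hx i) := Fin.ext (Nat.cast_injective (R := ℂ) hi)
    exact (Option.some_get (hx i)).symm.trans
      ((congrArg some hi'.symm).trans (Option.some_get (hy i)))
  subst hfg
  have hc := congrArg (fun γ => γ.cast rfl (proj_std_tgt hx)) hxy
  have h := cov.injective_path_homotopic_map _ _
    (a₁ := Path.Homotopic.Quotient.mk (orderedPath hx p))
    (a₂ := Path.Homotopic.Quotient.mk (orderedPath hy q)) hc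
  -- Relabelling by `f.src` undoes the relabelling in `orderedPath`.
  have h' := congrArg (fun γ => γ.map (Conf.pull f.src)) h
  exact congrArg (BraidedRook.mk f) h'

/-- A loop lifts to a path of ordered configurations, whose end point is a permutation of the nodes
and thus prescribes the connections of a diagram. -/
theorem exists_loop_eq (γ : Path.Homotopic.Quotient (UConf.base n) (UConf.base n)) :
    ∃ (x : BraidedRook n) (h : ∀ i, (x.conn i).isSome), loop x h = γ := by
  have cov := (Conf.isQuotientCoveringMap_proj n).isCoveringMap
  let e : Conf.proj n ⁻¹' {UConf.base n} := ⟨Conf.std (Function.Embedding.refl (Fin n)), rfl⟩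
  obtain ⟨P, hP⟩ := Path.Homotopic.Quotient.mk_surjective (cov.liftPathQuotient γ e)
  have hγ := cov.map_liftPathQuotient γ e
  rw [← hP] at hγ
  obtain ⟨σ, hσ⟩ := Conf.proj_eq_iff.1 (cov.monodromy γ e).2
  have hf (i : Fin n) : (σ.toPEquiv i).isSome := rfl
  let q : StrandPath σ.toPEquiv :=
    (P.map (Conf.pull σ.toPEquiv.src).continuous).cast rfl
      (Subtype.ext (funext fun i => hσ i.1))
  refine ⟨ofPath q, hf, ?_⟩
  have h : loop (ofPath q) hf = ((Path.Homotopic.Quotient.mk P).map (Conf.proj n)).cast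
      rfl (cov.monodromy γ e).2.symm := rfl
  rw [h]
  refine (congrArg (fun δ => δ.cast (e.2 : UConf.base n = _).symm
    (cov.monodromy γ e).2.symm) hγ).trans ?_
  exact (Path.Homotopic.Quotient.cast_cast ..).trans (Path.Homotopic.Quotient.cast_rfl_rfl γ)

end BraidedRook

/-! ### Diagrams with a missing edge -/

namespace BraidedRook

variable {n : ℕ}

/-- No strand ends at the right-hand node `j`. -/
def MissesRight (x : BraidedRook n) (j : Fin n) : Prop := x.conn.symm j = none

theorem exists_missesRight {x : BraidedRook n} (hx : ¬ x.Full) : ∃ j, x.MissesRight j := by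
  by_contra! h
  have h' (j : Fin n) : (x.conn.symm j).isSome := Option.isSome_iff_ne_none.2 (h j)
  exact hx ⟨isSome_symm h', h'⟩

theorem std_tgt_ofSet (j : Fin n) : Conf.std (PEquiv.ofSet {i | i ≠ j}).tgt =
    Conf.std (PEquiv.ofSet {i | i ≠ j}).src := by
  refine Subtype.ext (funext fun i => congrArg (fun l : Fin n => ((l : ℕ) : ℂ)) ?_)
  exact (PEquiv.mem_ofSet_iff.1 (Option.get_mem i.2)).1

/-- The horizontal strands, with the one at the node `j` removed. -/
def removeStrand (j : Fin n) : BraidedRook n :=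
  ofPath (f := PEquiv.ofSet {i | i ≠ j})
    ((Path.refl (Conf.std (PEquiv.ofSet {i | i ≠ j}).src)).cast rfl (std_tgt_ofSet j))

theorem removeStrand_conn_self (j : Fin n) : (removeStrand j).conn j = none :=
  if_neg (c := j ∈ {i | i ≠ j}) (not_not_intro rfl)

theorem removeStrand_conn_of_ne {i j : Fin n} (h : i ≠ j) :
    (removeStrand j).conn i = some i :=
  if_pos (c := i ∈ {i | i ≠ j}) h

theorem not_full_removeStrand (j : Fin n) : ¬ (removeStrand j).Full := fun h => by
  have hj := h.1 j
  rw [removeStrand_conn_self] at hj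
  cases hj

theorem MissesRight.mul_removeStrand {x : BraidedRook n} {j : Fin n} (h : x.MissesRight j)
    (i : Fin n) : (x * removeStrand i).MissesRight j := by
  change (x.conn.trans (removeStrand i).conn).symm j = none
  rw [PEquiv.symm_trans_rev, PEquiv.trans_apply']
  have hs : (removeStrand i).conn.symm = (removeStrand i).conn := PEquiv.ofSet_symm _
  rw [hs]
  by_cases hij : j = i
  · subst hij
    rw [removeStrand_conn_self]
    rfl
  · rw [removeStrand_conn_of_ne hij]
    exact h

theorem trans_ofSet_eq_self {f : Fin n ≃. Fin n} {j : Fin n} (h : f.symm j = none) :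
    f.trans (PEquiv.ofSet {i | i ≠ j}) = f := by
  refine PEquiv.ext fun i => ?_
  rw [PEquiv.trans_apply']
  cases hi : f i with
  | none => rfl
  | some l =>
    refine PEquiv.ofSet_eq_some_self_iff.2 ?_
    rintro rfl
    rw [f.eq_some_iff.2 hi] at h
    cases h

theorem MissesRight.mul_removeStrand_self {x : BraidedRook n} {j : Fin n}
    (h : x.MissesRight j) : x * removeStrand j = x := by
  obtain ⟨f, p, rfl⟩ := x.exists_ofPath
  have h : f.symm j = none := h
  rw [removeStrand, ofPath_mul]
  refine ofPath_congr (trans_ofSet_eq_self h) (r := p.trans (Path.refl _))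
    (Path.Homotopic.trans_refl p) ?_
  intro t i hi hi'
  rw [concat_apply, Path.trans_apply]
  split_ifs <;> rfl

theorem MissesRight.contractible_removeStrand {x : BraidedRook n} {j : Fin n}
    (h : x.MissesRight j) : contractible x (removeStrand j) = 1 := by
  rw [contractible, Finset.card_eq_one]
  refine ⟨j, Finset.ext fun i => ?_⟩
  rw [PEquiv.isolated, Finset.mem_filter, Finset.mem_singleton]
  constructor
  · rintro ⟨-, -, hi⟩
    by_contra hij
    rw [removeStrand_conn_of_ne hij] at hi
    cases hi
  · rintro rfl
    exact ⟨Finset.mem_univ _, h, removeStrand_conn_self _⟩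

/-! ### The braid of a diagram without missing edges -/

/-- The element of the braid group given by a diagram without missing edges. Loops in the
fundamental group are composed from right to left, whence the inverse. -/
def braid (x : BraidedRook n) (h : x.Full) : BraidGroup n :=
  (FundamentalGroup.fromPath (loop x h.1))⁻¹

theorem braid_mul {x y : BraidedRook n} (hx : x.Full) (hy : y.Full) (hxy : (x * y).Full) :
    braid (x * y) hxy = braid x hx * braid y hy := by
  rw [braid, loop_mul x y hx.1 hy.1 hxy.1]
  exact mul_inv_rev (FundamentalGroup.fromPath (loop y hy.1))
    (FundamentalGroup.fromPath (loop x hx.1))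

/-- An idempotent of a group is trivial. -/
theorem braid_one : braid (1 : BraidedRook n) full_one = 1 := by
  have h := braid_mul (x := (1 : BraidedRook n)) (y := 1) full_one full_one
    ((mul_one' (1 : BraidedRook n)).symm ▸ full_one)
  simp only [mul_one'] at h
  exact left_eq_mul.1 h

theorem braid_injective {x y : BraidedRook n} (hx : x.Full) (hy : y.Full)
    (h : braid x hx = braid y hy) : x = y :=
  loop_injective hx.1 hy.1 (inv_injective (G := BraidGroup n) h)

theorem exists_braid_eq (g : BraidGroup n) : ∃ (x : BraidedRook n) (h : x.Full), braid x h = g := by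
  obtain ⟨x, h, hx⟩ := exists_loop_eq (FundamentalGroup.toPath g⁻¹)
  refine ⟨x, ⟨h, isSome_symm h⟩, ?_⟩
  exact (congrArg (fun p => (FundamentalGroup.fromPath p)⁻¹) hx).trans (inv_inv g)

end BraidedRook

/-! ### The group algebra of the braid group as a quotient of the braided rook algebra -/

namespace BraidedRookAlgebra

open BraidedRook

variable {k : Type u} [CommRing k] {n : ℕ} {ε : k}

theorem diagram_mul (x y : BraidedRook n) :
    diagram ε x * diagram ε y = ε ^ contractible x y • diagram ε (x * y) :=
  mulMap_diagram x y

open Classical in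
/-- The projection onto the group algebra, killing the diagrams with a missing edge. -/
def toGroupAlgebra : BraidedRookAlgebra k n ε →ₐ[k] MonoidAlgebra k (BraidGroup n) :=
  AlgHom.ofLinearMap
    (lift fun x => if h : x.Full then MonoidAlgebra.of k (BraidGroup n) (braid x h) else 0)
    (by rw [one_def, lift_diagram, dif_pos full_one, braid_one, map_one])
    (by
      intro a b
      rw [mul_def]
      induction a using induction with
      | h0 => simp
      | hadd a a' h h' => simp only [map_add, LinearMap.add_apply, h, h', add_mul]
      | hsmul r a h => simp only [map_smul, LinearMap.smul_apply, h, smul_mul_assoc]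
      | hd x =>
      induction b using induction with
      | h0 => simp
      | hadd a a' h h' => simp only [map_add, h, h', mul_add]
      | hsmul r a h => simp only [map_smul, h, mul_smul_comm]
      | hd y =>
      rw [mulMap_diagram, map_smul, lift_diagram, lift_diagram, lift_diagram]
      by_cases hx : x.Full
      · rw [contractible_of_full hx, pow_zero, one_smul]
        by_cases hy : y.Full
        · have hxy := (full_mul x y).2 ⟨hx, hy⟩
          rw [dif_pos hx, dif_pos hy, dif_pos hxy, braid_mul hx hy, map_mul]
        · rw [dif_neg hy, dif_neg fun h => hy ((full_mul x y).1 h).2, mul_zero]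
      · rw [dif_neg hx, dif_neg fun h => hx ((full_mul x y).1 h).1, smul_zero, zero_mul])

theorem toGroupAlgebra_of_full {x : BraidedRook n} (h : x.Full) :
    toGroupAlgebra (diagram ε x) = MonoidAlgebra.of k (BraidGroup n) (braid x h) :=
  (lift_diagram _ x).trans (dif_pos h)

theorem toGroupAlgebra_of_not_full {x : BraidedRook n} (h : ¬ x.Full) :
    toGroupAlgebra (diagram ε x) = (0 : MonoidAlgebra k (BraidGroup n)) :=
  (lift_diagram _ x).trans (dif_neg h)

theorem groupAug_comp_toGroupAlgebra :
    (groupAug k (BraidGroup n)).comp toGroupAlgebra =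
      (aug : BraidedRookAlgebra k n ε →ₐ[k] k) := by
  classical
  refine AlgHom.toLinearMap_injective (hom_ext fun x => ?_)
  refine Eq.trans ?_ (lift_diagram _ x).symm
  change groupAug k (BraidGroup n) (toGroupAlgebra (diagram ε x)) = _
  by_cases h : x.Full
  · rw [toGroupAlgebra_of_full h, if_pos h, groupAug, MonoidAlgebra.lift_of, MonoidHom.one_apply]
  · rw [toGroupAlgebra_of_not_full h, if_neg h, map_zero]

/-- The linear map to the algebra which sends a braid to the corresponding diagram. -/
def ofGroupAlgebra (ε : k) : MonoidAlgebra k (BraidGroup n) →ₗ[k] BraidedRookAlgebra k n ε :=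
  Finsupp.linearCombination k (fun g => diagram ε (exists_braid_eq g).choose) ∘ₗ
    (MonoidAlgebra.coeffLinearEquiv k).toLinearMap

theorem ofGroupAlgebra_braid {x : BraidedRook n} (h : x.Full) :
    ofGroupAlgebra ε (MonoidAlgebra.of k (BraidGroup n) (braid x h)) = diagram ε x := by
  refine (Finsupp.linearCombination_single k (1 : k) (braid x h)).trans ?_
  obtain ⟨hy, e⟩ := (exists_braid_eq (braid x h)).choose_spec
  rw [one_smul, braid_injective hy h e]

theorem toGroupAlgebra_surjective :
    Function.Surjective (toGroupAlgebra : BraidedRookAlgebra k n ε →ₐ[k] _) := fun b => by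
  induction b using MonoidAlgebra.induction_on with
  | of g =>
    obtain ⟨x, h, rfl⟩ := exists_braid_eq g
    exact ⟨diagram ε x, toGroupAlgebra_of_full h⟩
  | add a b ha hb =>
    obtain ⟨a, rfl⟩ := ha
    obtain ⟨b, rfl⟩ := hb
    exact ⟨a + b, map_add _ _ _⟩
  | smul r a ha =>
    obtain ⟨a, rfl⟩ := ha
    exact ⟨r • a, map_smul _ _ _⟩

/-- The product of the elements `1 - δ e_j`, where `e_j` is the identity diagram with the strand
at `j` removed, for `j` in `l`. If `δ` is the inverse of `ε` and `l` contains all nodes, then every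
diagram with a missing edge annihilates it from the left. -/
def nonFullAnnihilator (ε δ : k) (l : List (Fin n)) : BraidedRookAlgebra k n ε :=
  (l.map fun j => 1 - δ • diagram ε (removeStrand j)).prod

theorem toGroupAlgebra_nonFullAnnihilator (δ : k) (l : List (Fin n)) :
    toGroupAlgebra (nonFullAnnihilator ε δ l) = 1 := by
  rw [nonFullAnnihilator, map_list_prod, List.map_map]
  refine List.prod_eq_one fun b hb => ?_
  obtain ⟨j, -, rfl⟩ := List.mem_map.1 hb
  rw [Function.comp_apply, map_sub, map_one, map_smul,
    toGroupAlgebra_of_not_full (not_full_removeStrand j), smul_zero, sub_zero]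

/-- The factors need not be commuted past each other: multiplying `x` by one of them produces only
diagrams which, like `x`, miss the node `j`, and the factor at `j` annihilates these. -/
theorem diagram_mul_nonFullAnnihilator {δ : k} (hδ : δ * ε = 1) {j : Fin n} (l : List (Fin n))
    (hj : j ∈ l) (x : BraidedRook n) (hx : x.MissesRight j) :
    diagram ε x * nonFullAnnihilator ε δ l = 0 := by
  induction l generalizing x with
  | nil => cases hj
  | cons i l ih =>
    have h : nonFullAnnihilator ε δ (i :: l) =
      (1 - δ • diagram ε (removeStrand i)) * nonFullAnnihilator ε δ l := List.prod_cons
    rw [h, ← mul_assoc, mul_sub, mul_one, mul_smul_comm, diagram_mul]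
    by_cases hij : j = i
    · subst hij
      rw [hx.contractible_removeStrand, hx.mul_removeStrand_self, pow_one, smul_smul, hδ,
        one_smul, sub_self, zero_mul]
    · have hl := (List.mem_cons.1 hj).resolve_left hij
      rw [sub_mul, ih hl x hx, smul_mul_assoc, smul_mul_assoc, ih hl _ (hx.mul_removeStrand i),
        smul_zero, smul_zero, sub_zero]

theorem nonempty_torTrivial_aug_iso (hε : IsUnit ε) (q : ℕ) :
    Nonempty (AlgebraTor.torTrivial (aug : BraidedRookAlgebra k n ε →ₐ[k] k) q ≅
      AlgebraTor.torTrivial (groupAug k (BraidGroup n)) q) := by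
  obtain ⟨δ, hδ⟩ := hε.exists_left_inv
  let f : BraidedRookAlgebra k n ε := nonFullAnnihilator ε δ (List.finRange n)
  rw [← groupAug_comp_toGroupAlgebra]
  refine AlgebraTor.nonempty_torTrivial_iso toGroupAlgebra toGroupAlgebra_surjective f
    (toGroupAlgebra_nonFullAnnihilator δ _)
    (LinearMap.mulRight k f ∘ₗ ofGroupAlgebra ε).toAddMonoidHom
    (fun a => ?_) _ q
  suffices h : (LinearMap.mulRight k f ∘ₗ ofGroupAlgebra ε) ∘ₗ toGroupAlgebra.toLinearMap =
      LinearMap.mulRight k f from LinearMap.congr_fun h a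
  refine hom_ext fun x => ?_
  change ofGroupAlgebra ε (toGroupAlgebra (diagram ε x)) * f = diagram ε x * f
  by_cases h : x.Full
  · rw [toGroupAlgebra_of_full h, ofGroupAlgebra_braid h]
  · obtain ⟨j, hj⟩ := exists_missesRight h
    rw [toGroupAlgebra_of_not_full h, map_zero, zero_mul,
      diagram_mul_nonFullAnnihilator hδ _ (List.mem_finRange j) x hj]

end BraidedRookAlgebra

end

theorem mainTheorem3 (k : Type u) [CommRing k] (n : ℕ) (ε : k) (hε : IsUnit ε) (q : ℕ) :
    Nonempty (AlgebraTor.torTrivial (BraidedRookAlgebra.aug : BraidedRookAlgebra k n ε →ₐ[k] k) q ≅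
        AlgebraTor.torTrivial (groupAug k (BraidGroup n)) q) ∧
      Nonempty (AlgebraTor.torTrivial (groupAug k (BraidGroup n)) q ≅
        groupHomology (Rep.trivial k (ULift.{u} (BraidGroup n)) k) q) :=
  ⟨BraidedRookAlgebra.nonempty_torTrivial_aug_iso hε q,
    nonempty_torTrivial_groupAug_iso_groupHomology k (BraidGroup n) q⟩
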